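/- Let $\mathbb F$ be an algebraically closed field of characteristic $0$ and let $G$ be a group. For $\bar g=(g_1,\dots,g_n)\in G^n$ let $\mathrm{Sym}(\bar g)$ be the set of $\sigma\in \mathrm{Sym}(n)$ with $g_1\cdots g_n=g_{\sigma(1)}\cdots g_{\sigma(n)}$, and write $\bar g^{\sigma}=(g_{\sigma(1)},\dots,g_{\sigma(n)})$. A $G$-commutation function is a function $\theta$ that assigns to each pair $(\bar g,\sigma)$ with $\bar g\in G^n$ and $\sigma\in \mathrm{Sym}(\bar g)$ a scalar $\theta_{(\bar g,\sigma)}\in\mathbb F^\times$, such that: 1. if $\bar g\in G^n$, $1\le i\le j\le n$, and $\sigma\in \mathrm{Sym}(\bar g)$ fixes every $k<i$ and every $k>j$, then $\theta_{(\bar g,\sigma)}=\theta_{((g_i,\dots,g_j),\tilde\sigma)}$, where $\tilde\sigma\in \mathrm{Sym}(j-i+1)$ is the restriction of $\sigma$ to $\{i,\dots,j\}$; 2. if $\bar h=(h_1,\dots,h_k)\in G^k$, $\sigma\in \mathrm{Sym}(\bar h)$, and $\bar g_i=(g_{i,1},\dots,g_{i,n_i})\in G^{n_i}$ with $n_i\ge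 1$ and $g_{i,1}\cdots g_{i,n_i}=h_i$ for $1\le i\le k$, then $\theta_{(\bar h,\sigma)}=\theta_{(\bar g,\tilde\sigma)}$, where $\bar g=(\bar g_1,\dots,\bar g_k)$ is the concatenation and $\tilde\sigma$ is the permutation moving the blocks according to $\sigma$, so that $\bar g^{\tilde\sigma}=(\bar g_{\sigma(1)},\dots,\bar g_{\sigma(k)})$; 3. $\theta_{(\bar g,\sigma)}\,\theta_{(\bar g^{\sigma},\tau)}=\theta_{(\bar g,\sigma\tau)}$ for all $\bar g\in G^n$, $\sigma\in \mathrm{Sym}(\bar g)$ and $\tau\in \mathrm{Sym}(\bar g^{\sigma})$. For $g\in G$ write $\theta_{g,g}=\theta_{((g,g),(1\,2))}$. Lemma. Let $\theta$ be a $G$-commutation function such that $\theta_{g,g}=1$ for all $g\in G$. Then there is a $2$-cocycle $\alpha\in Z^2(G,\mathbb F^\times)$ (for the trivial action of $G$ on $\mathbb F^\times$) such that the twisted group algebra $B=\mathbb F^{\alpha}G$ (with basis $\{U_g\}_{g\in G}$ and product $U_gU_h=\alpha(g,h)U_{gh}$), with its natural $G$-grading $B_g=\mathbb F U_g$, is regularly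 $G$-graded with commutation function $\theta$. That is, $B=\bigoplus_g B_g$ with $B_gB_h\subseteq B_{gh}$; for all $\bar g\in G^n$, all $\sigma\in\mathrm{Sym}(\bar g)$ and all $b_i\in B_{g_i}$, $$b_1\cdots b_n=\theta_{(\bar g,\sigma)}\,b_{\sigma(1)}\cdots b_{\sigma(n)};$$ and for every $\bar g\in G^n$ there are $b_i\in B_{g_i}$ with $b_1\cdots b_n\neq 0$. -/

import Mathlib

noncomputable section

namespace RegularGrading

universe u v w

/-! ## Tuples, permutations and commutation functions -/

section Tuples

variable {G : Type u} [Group G]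

/-- The set `Sym(g)` of all permutations `σ` of `{1, …, n}` such that
`g₁ ⋯ gₙ = g_{σ(1)} ⋯ g_{σ(n)}`. -/
def symTuple {n : ℕ} (g : Fin n → G) : Set (Equiv.Perm (Fin n)) :=
  {σ | (List.ofFn g).prod = (List.ofFn (g ∘ σ)).prod}

theorem mul_mem_symTuple {n : ℕ} {g : Fin n → G} {σ τ : Equiv.Perm (Fin n)}
    (hσ : σ ∈ symTuple g) (hτ : τ ∈ symTuple (g ∘ σ)) : σ * τ ∈ symTuple g :=
  Eq.trans hσ hτ

theorem swap_mem_symTuple {g h : G} (hgh : Commute g h) :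
    Equiv.swap (0 : Fin 2) 1 ∈ symTuple ![g, h] := by
  simpa [symTuple, List.ofFn_succ] using hgh.eq

/-- The segment `(g_i, …, g_{i+m-1})` of a tuple (positions are counted from `0`). -/
def tupleSegment {M : Type*} {n : ℕ} (g : Fin n → M) (i m : ℕ) (h : i + m ≤ n) : Fin m → M :=
  fun t => g ⟨i + t, by omega⟩

/-- The concatenation `(g_{1,1}, …, g_{1,n₁}, …, g_{k,1}, …, g_{k,n_k})` of `k` tuples. -/
def concatTuple {M : Type*} {k : ℕ} {N : Fin k → ℕ} (g : (i : Fin k) → Fin (N i) → M) :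
    Fin (∑ i, N i) → M :=
  fun x => g (finSigmaFinEquiv.symm x).1 (finSigmaFinEquiv.symm x).2

/-- The permutation of `{1, …, n₁ + ⋯ + n_k}` moving blocks of sizes `n₁, …, n_k` according to
`σ`: the `t`-th entry of the `i`-th block, in the list of blocks ordered as `σ(1), …, σ(k)`, is
sent to the `t`-th entry of block `σ(i)` in the original order. Thus permuting a concatenation
`(g₁, …, g_k)` of tuples by it gives `(g_{σ(1)}, …, g_{σ(k)})`. -/
def blockPerm {k : ℕ} (N : Fin k → ℕ) (σ : Equiv.Perm (Fin k)) :
    Equiv.Perm (Fin (∑ i, N i)) :=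
  (finCongr (Equiv.sum_comp σ N).symm).trans
    (((finSigmaFinEquiv (n := fun i => N (σ i))).symm.trans
      (Equiv.sigmaCongrLeft (β := fun i => Fin (N i)) σ)).trans finSigmaFinEquiv)

theorem prod_ofFn_sigma {M : Type*} [Monoid M] : ∀ {k : ℕ} {N : Fin k → ℕ}
    (f : Fin (∑ i, N i) → M),
    (List.ofFn f).prod =
      (List.ofFn fun i => (List.ofFn fun t => f (finSigmaFinEquiv ⟨i, t⟩)).prod).prod
  | 0, _, _ => by rw [List.ofFn_congr (Fin.sum_univ_zero _)]; simp
  | k + 1, N, f => by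
    have e : ∑ i, N i = (∑ i : Fin k, N i.castSucc) + N (Fin.last k) := Fin.sum_univ_castSucc N
    rw [List.ofFn_congr e, List.ofFn_add, List.prod_append, List.ofFn_succ', List.concat_eq_append,
      List.prod_append, List.prod_singleton,
      prod_ofFn_sigma (N := fun i : Fin k => N i.castSucc)]
    congr 3
    · funext i
      congr 2
      funext t
      apply congrArg f
      apply Fin.ext
      simp [finSigmaFinEquiv_apply]
    · funext t
      apply congrArg f
      apply Fin.ext
      simp [finSigmaFinEquiv_apply]
      rfl

theorem concatTuple_apply {M : Type*} {k : ℕ} {N : Fin k → ℕ} (g : (i : Fin k) → Fin (N i) → M)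
    (i : Fin k) (t : Fin (N i)) : concatTuple g (finSigmaFinEquiv ⟨i, t⟩) = g i t := by
  have key : ∀ s : (i : Fin k) × Fin (N i), s = ⟨i, t⟩ → g s.1 s.2 = g i t := by
    rintro _ rfl; rfl
  exact key _ (Equiv.symm_apply_apply _ _)

theorem blockPerm_apply {k : ℕ} (N : Fin k → ℕ) (σ : Equiv.Perm (Fin k)) (i : Fin k)
    (t : Fin (N (σ i))) :
    blockPerm N σ (Fin.cast (Equiv.sum_comp σ N)
      (finSigmaFinEquiv (n := fun i => N (σ i)) ⟨i, t⟩)) = finSigmaFinEquiv ⟨σ i, t⟩ := by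
  have h : (finSigmaFinEquiv (n := fun i => N (σ i))).symm
      (finSigmaFinEquiv (n := fun i => N (σ i)) ⟨i, t⟩) = ⟨i, t⟩ := Equiv.symm_apply_apply _ _
  change finSigmaFinEquiv (Equiv.sigmaCongrLeft (β := fun i => Fin (N i)) σ
    ((finSigmaFinEquiv (n := fun i => N (σ i))).symm
      (finSigmaFinEquiv (n := fun i => N (σ i)) ⟨i, t⟩))) = _
  rw [h]
  rfl

theorem blockPerm_mem_symTuple {k : ℕ} {N : Fin k → ℕ} {h : Fin k → G}
    {g : (i : Fin k) → Fin (N i) → G} (hg : ∀ i, (List.ofFn (g i)).prod = h i)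
    {σ : Equiv.Perm (Fin k)} (hσ : σ ∈ symTuple h) :
    blockPerm N σ ∈ symTuple (concatTuple g) := by
  have h1 : (List.ofFn (concatTuple g)).prod = (List.ofFn h).prod := by
    rw [prod_ofFn_sigma]
    congr 2
    funext i
    rw [← hg i]
    congr 2
    funext t
    exact concatTuple_apply g i t
  have h2 : (List.ofFn (concatTuple g ∘ blockPerm N σ)).prod = (List.ofFn (h ∘ σ)).prod := by
    rw [List.ofFn_congr (Equiv.sum_comp σ N).symm, prod_ofFn_sigma (N := fun i => N (σ i))]
    congr 2
    funext i
    rw [Function.comp_apply, ← hg (σ i)]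
    congr 2
    funext t
    have : blockPerm N σ (Fin.cast (Equiv.sum_comp σ N)
        (finSigmaFinEquiv (n := fun i => N (σ i)) ⟨i, t⟩)) = finSigmaFinEquiv ⟨σ i, t⟩ :=
      blockPerm_apply N σ i t
    rw [Function.comp_apply, this, concatTuple_apply]
  exact h1.trans (Eq.trans hσ h2.symm)

end Tuples

/-- A function assigning a nonzero scalar to every pair `(g, σ)` with `g ∈ Gⁿ`, `σ ∈ Sym(g)`. -/
abbrev PairFunction (G : Type u) [Group G] (F : Type v) [Field F] : Type (max u v) :=
  (n : ℕ) → (g : Fin n → G) → symTuple g → Fˣ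

section Commutation

variable {G : Type u} [Group G] {F : Type v} [Field F]

/-- For commuting `g, h`, the scalar `θ_{g,h} = θ_{((g,h),(1 2))}`. -/
def PairFunction.pair (θ : PairFunction G F) (g h : G) (hgh : Commute g h) : Fˣ :=
  θ 2 ![g, h] ⟨Equiv.swap 0 1, swap_mem_symTuple hgh⟩

/-- `G`-commutation functions. -/
structure IsCommutationFunction (θ : PairFunction G F) : Prop where
  /-- If `σ` fixes all positions outside a segment `{i, …, i+m-1}`, then `θ(g, σ)` equals the
  value of `θ` at the segment and at the restriction `τ` of `σ` to it. -/
  restrict : ∀ {n : ℕ} (g : Fin n → G) (σ : symTuple g) (i m : ℕ) (_ : 0 < m) (h : i + m ≤ n),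
    (∀ k : Fin n, ((k : ℕ) < i ∨ i + m ≤ (k : ℕ)) → σ.1 k = k) →
    ∀ τ : symTuple (tupleSegment g i m h),
      (∀ t : Fin m, (σ.1 ⟨i + t, by omega⟩ : ℕ) = i + (τ.1 t : ℕ)) →
      θ n g σ = θ m (tupleSegment g i m h) τ
  /-- Replacing each `h_i` by a nonempty block with product `h_i`, and `σ` by the permutation
  that moves the blocks accordingly, does not change the value of `θ`. -/
  block : ∀ {k : ℕ} (h : Fin k → G) (N : Fin k → ℕ) (_ : ∀ i, 0 < N i)
    (g : (i : Fin k) → Fin (N i) → G) (hg : ∀ i, (List.ofFn (g i)).prod = h i)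
    (σ : symTuple h),
    θ k h σ = θ (∑ i, N i) (concatTuple g) ⟨blockPerm N σ.1, blockPerm_mem_symTuple hg σ.2⟩
  /-- `θ(g, σ) θ(g^σ, τ) = θ(g, στ)`, where `g^σ = (g_{σ(1)}, …, g_{σ(n)})`. -/
  mul : ∀ {n : ℕ} (g : Fin n → G) (σ : symTuple g) (τ : symTuple (g ∘ σ.1)),
    θ n g σ * θ n (g ∘ σ.1) τ = θ n g ⟨σ.1 * τ.1, mul_mem_symTuple σ.2 τ.2⟩

/-! ## Regular gradings -/

/-- A `G`-grading on an algebra: `A = ⨁_g A_g` with `A_g A_h ⊆ A_{gh}`. -/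
structure IsGrading {A : Type w} [Ring A] [Algebra F A] (𝒜 : G → Submodule F A) : Prop where
  indep : iSupIndep 𝒜
  iSup_eq_top : iSup 𝒜 = ⊤
  mul_mem : ∀ {g h : G} {a b : A}, a ∈ 𝒜 g → b ∈ 𝒜 h → a * b ∈ 𝒜 (g * h)

/-- The family `𝒜` is a regular `G`-grading on `A`, with commutation function `θ`. -/
structure IsRegularGradingWith {A : Type w} [Ring A] [Algebra F A] (𝒜 : G → Submodule F A)
    (θ : PairFunction G F) : Prop extends IsGrading 𝒜 where
  /-- `a₁ ⋯ aₙ = θ(g, σ) a_{σ(1)} ⋯ a_{σ(n)}` for homogeneous `a_i ∈ A_{g_i}`. -/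
  commutation : ∀ {n : ℕ} (g : Fin n → G) (σ : symTuple g) (a : Fin n → A),
    (∀ i, a i ∈ 𝒜 (g i)) →
    (List.ofFn a).prod = (θ n g σ : F) • (List.ofFn (a ∘ σ.1)).prod
  /-- For every `g ∈ Gⁿ` some product of `a_i ∈ A_{g_i}` is nonzero. -/
  regularity : ∀ {n : ℕ} (g : Fin n → G), ∃ a : Fin n → A,
    (∀ i, a i ∈ 𝒜 (g i)) ∧ (List.ofFn a).prod ≠ 0

end Commutation

/-! ## Two-cocycles and twisted group algebras -/

/-- `Z²(G, F^×)`: the 2-cocycles on `G` with values in `F^×`, for the trivial action. -/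
def TwoCocycle (G : Type u) [Group G] (F : Type v) [Field F] : Type (max u v) :=
  {α : G × G → Fˣ // @groupCohomology.IsMulCocycle₂ G Fˣ _ _ ⟨fun _ u => u⟩ α}

variable {G : Type u} [Group G] {F : Type v} [Field F]

instance : CoeFun (TwoCocycle G F) (fun _ => G × G → Fˣ) := ⟨Subtype.val⟩

theorem TwoCocycle.mul_eq (α : TwoCocycle G F) (g h k : G) :
    α (g * h, k) * α (g, h) = α (h, k) * α (g, h * k) :=
  α.2 g h k

section TwistedMul

variable (α : TwoCocycle G F)

/-- The bilinear multiplication with `U_g U_h = α(g, h) U_{gh}` on the vector space with basis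
`U_g = single g 1`, `g ∈ G`. -/
def twistedMul (x y : G →₀ F) : G →₀ F :=
  x.sum fun g a => y.sum fun h b => Finsupp.single (g * h) (a * b * (α (g, h) : F))

theorem twistedMul_single (g h : G) (a b : F) :
    twistedMul α (Finsupp.single g a) (Finsupp.single h b) =
      Finsupp.single (g * h) (a * b * (α (g, h) : F)) := by
  rw [twistedMul, Finsupp.sum_single_index, Finsupp.sum_single_index] <;> simp

theorem add_twistedMul (x y z : G →₀ F) :
    twistedMul α (x + y) z = twistedMul α x z + twistedMul α y z := by
  refine Finsupp.sum_add_index' ?_ ?_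
  · intro g; simp
  · intro g a b; simp only [add_mul, Finsupp.single_add]; exact Finsupp.sum_add

theorem twistedMul_add (x y z : G →₀ F) :
    twistedMul α x (y + z) = twistedMul α x y + twistedMul α x z := by
  unfold twistedMul
  rw [← Finsupp.sum_add]
  congr 1
  funext g a
  refine Finsupp.sum_add_index' ?_ ?_
  · intro h; simp
  · intro h b c; simp only [mul_add, add_mul, Finsupp.single_add]

theorem zero_twistedMul (x : G →₀ F) : twistedMul α 0 x = 0 := Finsupp.sum_zero_index

theorem twistedMul_zero (x : G →₀ F) : twistedMul α x 0 = 0 := by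
  simp [twistedMul]

theorem twistedMul_assoc (x y z : G →₀ F) :
    twistedMul α (twistedMul α x y) z = twistedMul α x (twistedMul α y z) := by
  induction x using Finsupp.induction_linear with
  | zero => simp only [zero_twistedMul]
  | add x x' hx hx' => simp only [add_twistedMul, hx, hx']
  | single g a =>
    induction y using Finsupp.induction_linear with
    | zero => simp only [zero_twistedMul, twistedMul_zero]
    | add y y' hy hy' => simp only [add_twistedMul, twistedMul_add, hy, hy']
    | single h b =>
      induction z using Finsupp.induction_linear with
      | zero => simp only [twistedMul_zero]
      | add z z' hz hz' => simp only [twistedMul_add, hz, hz']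
      | single k c =>
        simp only [twistedMul_single, mul_assoc g h k]
        congr 1
        have := congrArg Units.val (α.mul_eq g h k)
        simp only [Units.val_mul] at this
        linear_combination a * b * c * this

/-- The unit element `α(1, 1)⁻¹ U_1`. -/
def twistedOne : G →₀ F := Finsupp.single 1 (((α (1, 1))⁻¹ : Fˣ) : F)

theorem twistedOne_mul (x : G →₀ F) : twistedMul α (twistedOne α) x = x := by
  induction x using Finsupp.induction_linear with
  | zero => exact twistedMul_zero α _
  | add x y hx hy => rw [twistedMul_add, hx, hy]
  | single g a =>
    rw [twistedOne, twistedMul_single, one_mul]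
    congr 1
    have := α.mul_eq 1 1 g
    simp only [one_mul] at this
    have h : α (1, 1) = α (1, g) := mul_left_cancel this
    rw [← h, mul_comm _ a, mul_assoc, Units.inv_mul, mul_one]

theorem twistedMul_one (x : G →₀ F) : twistedMul α x (twistedOne α) = x := by
  induction x using Finsupp.induction_linear with
  | zero => exact zero_twistedMul α _
  | add x y hx hy => rw [add_twistedMul, hx, hy]
  | single g a =>
    rw [twistedOne, twistedMul_single, mul_one]
    congr 1
    have := α.mul_eq g 1 1
    simp only [mul_one] at this
    have h : α (g, 1) = α (1, 1) := mul_right_cancel this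
    rw [h, mul_assoc, Units.inv_mul, mul_one]

theorem smul_twistedMul (c : F) (x y : G →₀ F) :
    twistedMul α (c • x) y = c • twistedMul α x y := by
  induction x using Finsupp.induction_linear with
  | zero => simp only [smul_zero, zero_twistedMul]
  | add x x' hx hx' => simp only [smul_add, add_twistedMul, hx, hx']
  | single g a =>
    induction y using Finsupp.induction_linear with
    | zero => simp only [smul_zero, twistedMul_zero]
    | add y y' hy hy' => simp only [smul_add, twistedMul_add, hy, hy']
    | single h b => simp only [Finsupp.smul_single, twistedMul_single, smul_eq_mul, mul_assoc]

theorem twistedMul_smul (c : F) (x y : G →₀ F) :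
    twistedMul α x (c • y) = c • twistedMul α x y := by
  induction x using Finsupp.induction_linear with
  | zero => simp only [smul_zero, zero_twistedMul]
  | add x x' hx hx' => simp only [smul_add, add_twistedMul, hx, hx']
  | single g a =>
    induction y using Finsupp.induction_linear with
    | zero => simp only [smul_zero, twistedMul_zero]
    | add y y' hy hy' => simp only [smul_add, twistedMul_add, hy, hy']
    | single h b =>
      simp only [Finsupp.smul_single, twistedMul_single, smul_eq_mul, mul_assoc,
        mul_left_comm c]

end TwistedMul

/-- The twisted group algebra `F^α G`: the vector space with basis `U_g`, `g ∈ G`, and the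
bilinear multiplication with `U_g U_h = α(g, h) U_{gh}`. -/
def TwistedGroupAlgebra (_α : TwoCocycle G F) : Type (max u v) := G →₀ F

namespace TwistedGroupAlgebra

variable (α : TwoCocycle G F)

instance : AddCommGroup (TwistedGroupAlgebra α) := inferInstanceAs (AddCommGroup (G →₀ F))
instance : Module F (TwistedGroupAlgebra α) := inferInstanceAs (Module F (G →₀ F))

instance : Ring (TwistedGroupAlgebra α) :=
  { (inferInstance : AddCommGroup (TwistedGroupAlgebra α)) with
    mul := twistedMul α
    one := twistedOne α
    left_distrib := twistedMul_add α
    right_distrib := add_twistedMul α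
    zero_mul := zero_twistedMul α
    mul_zero := twistedMul_zero α
    mul_assoc := twistedMul_assoc α
    one_mul := twistedOne_mul α
    mul_one := twistedMul_one α }

instance : Algebra F (TwistedGroupAlgebra α) :=
  Algebra.ofModule (smul_twistedMul α) (fun c x y => twistedMul_smul α c x y)

/-- The basis element `U_g`. -/
def U (g : G) : TwistedGroupAlgebra α := Finsupp.single g (1 : F)

theorem U_mul_U (g h : G) : U α g * U α h = (α (g, h) : F) • U α (g * h) :=
  (twistedMul_single α g h 1 1).trans
    (by rw [one_mul, one_mul]; exact (Finsupp.smul_single_one (g * h) (α (g, h) : F)).symm)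

/-- The homogeneous component `(F^α G)_g = F U_g` of the natural `G`-grading. -/
def component (g : G) : Submodule F (TwistedGroupAlgebra α) :=
  Submodule.span F {U α g}

end TwistedGroupAlgebra

end RegularGrading

end

/-! Read θ as the price of rearranging words: `Rearranges θ γ l m c` turns `l` into `m` at price
`c`. Prices multiply along composites, do not change when a word is placed in a larger one, and a
block costs as much to move as its product. Moving (1,1) past y, at once or letter by letter, gives
θ_{1,y} = θ_{1,y}², so words with product 1 move past everything for free.

The price could still depend on which of several equal letters goes where. Exchanging two letters of
degree g costs the same across any word between them (`exchange_of_exchange_inv`), namely θ_{g,g} =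
1. Hence permutations fixing a tuple cost 1, and the price depends only on the two words
(`Rearranges.unique`).

Now take pairs of a scalar and a word with product 1, and identify (1, l) with (c, m) whenever `l`
becomes `m` at price c. The quotient is a commutative monoid, and uniqueness of prices embeds Fˣ in
its Grothendieck group. As Fˣ is divisible, it is a retract of that group. The retraction gives a φ,
multiplicative on words with product 1, with φ(l) = c φ(m).

For a word l with product g put s(l) = φ(l g⁻¹) / φ(g g⁻¹). Then α(g,h) = s(g,h) is a cocycle,
U_{g₁}⋯U_{gₙ} = s(g₁,…,gₙ) U_{g₁⋯gₙ}, and commutation is the rule s(l) = c s(m). -/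

namespace RegularGrading

universe u v w

/-! ### Permutations of positions and words. -/

section Permutations

/-- The permutation `σ` acting on the middle `n` of `p + n + q` positions. -/
def middlePerm (p : ℕ) {n : ℕ} (q : ℕ) (σ : Equiv.Perm (Fin n)) : Equiv.Perm (Fin (p + n + q)) :=
  finSumFinEquiv.permCongr
    (Equiv.Perm.sumCongr (finSumFinEquiv.permCongr (Equiv.Perm.sumCongr 1 σ)) 1)

theorem middlePerm_left {p n q : ℕ} (σ : Equiv.Perm (Fin n)) (i : Fin p) :
    middlePerm p q σ (Fin.castAdd q (Fin.castAdd n i)) = Fin.castAdd q (Fin.castAdd n i) := by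
  simp [middlePerm, Equiv.permCongr_apply]

theorem middlePerm_mid {p n q : ℕ} (σ : Equiv.Perm (Fin n)) (i : Fin n) :
    middlePerm p q σ (Fin.castAdd q (Fin.natAdd p i)) = Fin.castAdd q (Fin.natAdd p (σ i)) := by
  simp [middlePerm, Equiv.permCongr_apply]

theorem middlePerm_right {p n q : ℕ} (σ : Equiv.Perm (Fin n)) (i : Fin q) :
    middlePerm p q σ (Fin.natAdd (p + n) i) = Fin.natAdd (p + n) i := by
  simp [middlePerm, Equiv.permCongr_apply]

theorem append_comp_middlePerm {M : Type*} {p n q : ℕ} (a : Fin p → M) (b : Fin n → M)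
    (c : Fin q → M) (σ : Equiv.Perm (Fin n)) :
    Fin.append (Fin.append a b) c ∘ middlePerm p q σ = Fin.append (Fin.append a (b ∘ σ)) c := by
  funext x
  refine Fin.addCases (fun y => ?_) (fun y => ?_) x
  · refine Fin.addCases (fun z => ?_) (fun z => ?_) y
    · simp [middlePerm_left]
    · simp [middlePerm_mid]
  · simp [middlePerm_right]

theorem perm_exchange {ι : Type*} (x z : ι) (w : List ι) :
    ([x] ++ w ++ [z]).Perm ([z] ++ w ++ [x]) := by
  classical
  rw [List.perm_iff_count]
  intro a
  simp only [List.count_append]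
  omega

/-- If two lists are rearrangements of each other, then a permutation of the positions carries
one to the other. -/
theorem exists_ofFn_comp_of_perm {ι : Type*} {l m : List ι} (h : l.Perm m) :
    ∃ (n : ℕ) (a : Fin n → ι) (σ : Equiv.Perm (Fin n)),
      l = List.ofFn a ∧ m = List.ofFn (a ∘ σ) := by
  induction h with
  | nil => exact ⟨0, Fin.elim0, 1, by simp, by simp⟩
  | cons x _ ih =>
    obtain ⟨n, a, σ, rfl, rfl⟩ := ih
    refine ⟨1 + n + 0, Fin.append (Fin.append ![x] a) Fin.elim0, middlePerm 1 0 σ, ?_, ?_⟩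
    · rw [List.ofFn_fin_append, List.ofFn_fin_append]; simp
    · rw [append_comp_middlePerm, List.ofFn_fin_append, List.ofFn_fin_append]; simp
  | swap x y l =>
    refine ⟨0 + 2 + l.length, Fin.append (Fin.append Fin.elim0 ![y, x]) l.get,
      middlePerm 0 l.length (Equiv.swap 0 1), ?_, ?_⟩
    · rw [List.ofFn_fin_append, List.ofFn_fin_append, List.ofFn_get]; simp
    · rw [append_comp_middlePerm, List.ofFn_fin_append, List.ofFn_fin_append, List.ofFn_get]; simp
  | trans _ _ ih₁ ih₂ =>
    obtain ⟨n, a, σ, rfl, rfl⟩ := ih₁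
    obtain ⟨m, b, τ, h, rfl⟩ := ih₂
    have hn := List.ofFn_inj'.1 h
    obtain ⟨rfl, hb⟩ := Sigma.mk.inj_iff.1 hn
    obtain rfl := eq_of_heq hb
    exact ⟨n, a, σ * τ, rfl, rfl⟩

/-- This is `prod_ofFn_sigma` in the free monoid, where products are concatenations. -/
theorem ofFn_eq_flatten {M : Type*} {k : ℕ} {N : Fin k → ℕ} (f : Fin (∑ i, N i) → M) :
    List.ofFn f =
      (List.ofFn fun i => List.ofFn fun t => f (finSigmaFinEquiv ⟨i, t⟩)).flatten := by
  have key : ∀ {n : ℕ} (a : Fin n → M),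
      FreeMonoid.toList (List.ofFn fun i => FreeMonoid.of (a i)).prod = List.ofFn a := by
    intro n a
    rw [FreeMonoid.toList_prod, List.map_ofFn]
    change (List.ofFn ((fun x => [x]) ∘ a)).flatten = _
    rw [← List.map_ofFn, ← List.flatMap_def, List.flatMap_singleton']
  have h := congrArg FreeMonoid.toList (prod_ofFn_sigma fun x => FreeMonoid.of (f x))
  rw [key, FreeMonoid.toList_prod, List.map_ofFn] at h
  rw [h]
  congr 2
  funext i
  exact key _

theorem ofFn_concatTuple {M : Type*} {k : ℕ} {N : Fin k → ℕ} (g : (i : Fin k) → Fin (N i) → M) :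
    List.ofFn (concatTuple g) = (List.ofFn fun i => List.ofFn (g i)).flatten := by
  rw [ofFn_eq_flatten]
  simp only [concatTuple_apply]

theorem ofFn_concatTuple_comp_blockPerm {M : Type*} {k : ℕ} {N : Fin k → ℕ}
    (g : (i : Fin k) → Fin (N i) → M) (σ : Equiv.Perm (Fin k)) :
    List.ofFn (concatTuple g ∘ blockPerm N σ) =
      (List.ofFn fun i => List.ofFn (g (σ i))).flatten := by
  rw [List.ofFn_congr (Equiv.sum_comp σ N).symm, ofFn_eq_flatten (N := fun i => N (σ i))]
  congr 2
  funext i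
  congr 1
  funext t
  have : blockPerm N σ (Fin.cast (Equiv.sum_comp σ N)
      (finSigmaFinEquiv (n := fun i => N (σ i)) ⟨i, t⟩)) = finSigmaFinEquiv ⟨σ i, t⟩ :=
    blockPerm_apply N σ i t
  rw [Function.comp_apply, this, concatTuple_apply]

end Permutations

/-! ### Scalars of rearrangements and their uniqueness. -/

section Rearrangement

variable {G : Type u} [Group G] {F : Type v} [Field F] {ι : Type w}

/-- The list `m` is obtained by rearranging the list `l` of letters, which have degrees given
by `γ`, and the scalar `θ` attached to that rearrangement is `c`. -/
def Rearranges (θ : PairFunction G F) (γ : ι → G) (l m : List ι) (c : Fˣ) : Prop :=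
  ∃ (n : ℕ) (a : Fin n → ι) (σ : symTuple (γ ∘ a)),
    l = List.ofFn a ∧ m = List.ofFn (a ∘ σ.1) ∧ θ n (γ ∘ a) σ = c

variable {θ : PairFunction G F} (hθ : IsCommutationFunction θ) {γ : ι → G}

theorem one_mem_symTuple {n : ℕ} (g : Fin n → G) : 1 ∈ symTuple g := rfl

include hθ in
theorem IsCommutationFunction.apply_one {n : ℕ} (g : Fin n → G) (h : 1 ∈ symTuple g) :
    θ n g ⟨1, h⟩ = 1 :=
  mul_eq_left.1 (hθ.mul g ⟨1, h⟩ ⟨1, h⟩)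

namespace Rearranges

include hθ

theorem refl (l : List ι) : Rearranges θ γ l l 1 :=
  ⟨l.length, l.get, ⟨1, rfl⟩, by simp, by simp, hθ.apply_one _ _⟩

theorem trans {l m k : List ι} {c d : Fˣ} (h : Rearranges θ γ l m c)
    (h' : Rearranges θ γ m k d) : Rearranges θ γ l k (c * d) := by
  obtain ⟨n, a, σ, rfl, rfl, rfl⟩ := h
  obtain ⟨m, b, τ, h, rfl, rfl⟩ := h'
  obtain ⟨rfl, hb⟩ := Sigma.mk.inj_iff.1 (List.ofFn_inj'.1 h)
  obtain rfl := eq_of_heq hb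
  exact ⟨n, a, ⟨σ.1 * τ.1, mul_mem_symTuple σ.2 τ.2⟩, rfl, rfl, (hθ.mul _ σ τ).symm⟩

theorem symm {l m : List ι} {c : Fˣ} (h : Rearranges θ γ l m c) : Rearranges θ γ m l c⁻¹ := by
  obtain ⟨n, a, σ, rfl, rfl, rfl⟩ := h
  have e : (γ ∘ (a ∘ σ.1)) ∘ (σ.1⁻¹ : Equiv.Perm (Fin n)) = γ ∘ a := by
    funext i; simp
  have hs : σ.1⁻¹ ∈ symTuple (γ ∘ (a ∘ σ.1)) := by
    change _ = _
    rw [e]; exact Eq.symm σ.2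
  refine ⟨n, a ∘ σ.1, ⟨σ.1⁻¹, hs⟩, rfl, ?_, ?_⟩
  · congr 1; funext i; simp
  · have h1 := hθ.mul (γ ∘ a) σ ⟨σ.1⁻¹, hs⟩
    have h2 : (⟨σ.1 * σ.1⁻¹, mul_mem_symTuple σ.2 hs⟩ : symTuple (γ ∘ a)) =
        ⟨1, one_mem_symTuple _⟩ :=
      Subtype.ext (mul_inv_cancel _)
    rw [h2, hθ.apply_one] at h1
    exact eq_inv_of_mul_eq_one_right h1

omit hθ in
theorem exists_of_perm {l m : List ι} (h : l.Perm m) (hp : (l.map γ).prod = (m.map γ).prod) :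
    ∃ c, Rearranges θ γ l m c := by
  obtain ⟨n, a, σ, rfl, rfl⟩ := exists_ofFn_comp_of_perm h
  rw [List.map_ofFn, List.map_ofFn] at hp
  exact ⟨_, n, a, ⟨σ, hp⟩, rfl, rfl, rfl⟩

omit hθ in
theorem prod_eq {l m : List ι} {c : Fˣ} (h : Rearranges θ γ l m c) :
    (l.map γ).prod = (m.map γ).prod := by
  obtain ⟨n, a, σ, rfl, rfl, -⟩ := h
  rw [List.map_ofFn, List.map_ofFn]
  exact σ.2

omit hθ in
theorem perm {l m : List ι} {c : Fˣ} (h : Rearranges θ γ l m c) : l.Perm m := by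
  obtain ⟨n, a, σ, rfl, rfl, -⟩ := h
  exact (Equiv.Perm.ofFn_comp_perm _ _).symm

omit hθ in
-- Distinct letters leave only one possible permutation. This is how the scalars of two routes
-- between the same words are compared before `unique` is available.
theorem unique_of_nodup {l m : List ι} (hl : l.Nodup) {c d : Fˣ} (h : Rearranges θ γ l m c)
    (h' : Rearranges θ γ l m d) : c = d := by
  obtain ⟨n, a, σ, rfl, rfl, rfl⟩ := h
  obtain ⟨m, b, τ, h1, h2, rfl⟩ := h'
  obtain ⟨rfl, hb⟩ := Sigma.mk.inj_iff.1 (List.ofFn_inj'.1 h1)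
  obtain rfl := eq_of_heq hb
  have ha := List.nodup_ofFn.1 hl
  have : σ = τ := Subtype.ext (Equiv.ext fun i => ha (congrFun (List.ofFn_injective h2) i))
  rw [this]

omit hθ in
theorem map {κ : Type*} {γ : κ → G} (f : ι → κ) {l m : List ι} {c : Fˣ}
    (h : Rearranges θ (γ ∘ f) l m c) : Rearranges θ γ (l.map f) (m.map f) c := by
  obtain ⟨n, a, σ, rfl, rfl, rfl⟩ := h
  exact ⟨n, f ∘ a, σ, by rw [List.map_ofFn], by rw [List.map_ofFn]; rfl, rfl⟩

theorem append_append {l m : List ι} {c : Fˣ} (h : Rearranges θ γ l m c) (k k' : List ι) :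
    Rearranges θ γ (k ++ l ++ k') (k ++ m ++ k') c := by
  obtain ⟨n, a, σ, rfl, rfl, rfl⟩ := h
  -- The restriction axiom needs a segment of positive length.
  rcases Nat.eq_zero_or_pos n with rfl | hn
  · have : θ 0 (γ ∘ a) σ = 1 := by
      rw [← hθ.apply_one (γ ∘ a) rfl]
      congr 1
      exact Subtype.ext (Subsingleton.elim _ _)
    rw [this]
    simpa using refl hθ (k ++ k')
  · have e1 : k ++ List.ofFn a ++ k' =
        List.ofFn (Fin.append (Fin.append k.get a) k'.get) := by
      rw [List.ofFn_fin_append, List.ofFn_fin_append, List.ofFn_get, List.ofFn_get]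
    have e2 : k ++ List.ofFn (a ∘ σ.1) ++ k' =
        List.ofFn (Fin.append (Fin.append k.get a) k'.get ∘ middlePerm k.length k'.length σ.1) := by
      rw [append_comp_middlePerm, List.ofFn_fin_append, List.ofFn_fin_append, List.ofFn_get,
        List.ofFn_get]
    have hs : middlePerm k.length k'.length σ.1 ∈
        symTuple (γ ∘ Fin.append (Fin.append k.get a) k'.get) := by
      change _ = _
      rw [Function.comp_assoc, ← List.map_ofFn, ← List.map_ofFn, ← e1, ← e2]
      have := σ.2
      simp only [symTuple, Set.mem_ofPred_eq] at this
      simp only [List.map_append, List.prod_append, List.map_ofFn]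
      rw [this, Function.comp_assoc]
    have hseg : tupleSegment (γ ∘ Fin.append (Fin.append k.get a) k'.get) k.length n (by omega) =
        γ ∘ a := by
      funext t
      have : (⟨k.length + t, by omega⟩ : Fin (k.length + n + k'.length)) =
          Fin.castAdd _ (Fin.natAdd _ t) := rfl
      rw [tupleSegment, Function.comp_apply, this]
      simp
    refine ⟨_, _, ⟨_, hs⟩, e1, e2, ?_⟩
    have key : ∀ (g : Fin n → G) (_ : g = γ ∘ a) (τ : symTuple g), τ.1 = σ.1 →
        θ n g τ = θ n (γ ∘ a) σ := by
      rintro _ rfl τ h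
      rw [Subtype.ext h]
    refine (hθ.restrict _ ⟨_, hs⟩ k.length n hn (by omega) ?_ ⟨σ.1, ?_⟩ ?_).trans
      (key _ hseg _ rfl)
    · intro x
      refine Fin.addCases (fun y => ?_) (fun y => ?_) x
      · refine Fin.addCases (fun z => ?_) (fun z => ?_) y
        · intro _; exact middlePerm_left _ _
        · intro h; simp at h; omega
      · intro _; exact middlePerm_right _ _
    · rw [hseg]; exact σ.2
    · intro t
      exact congrArg Fin.val (middlePerm_mid σ.1 t)

theorem append_left {l m : List ι} {c : Fˣ} (h : Rearranges θ γ l m c) (k : List ι) :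
    Rearranges θ γ (k ++ l) (k ++ m) c := by
  simpa using append_append hθ h k []

theorem append_right {l m : List ι} {c : Fˣ} (h : Rearranges θ γ l m c) (k : List ι) :
    Rearranges θ γ (l ++ k) (m ++ k) c := by
  simpa using append_append hθ h [] k

/-- The block axiom for the transposition of `(x, y)`; it only admits nonempty blocks. -/
theorem append_comm {l m : List ι} (hl : l ≠ []) (hm : m ≠ []) {x y : G}
    (hx : (l.map γ).prod = x) (hy : (m.map γ).prod = y) (h : Commute x y) :
    Rearranges θ γ (l ++ m) (m ++ l) (θ.pair x y h) := by
  let L : Fin 2 → List ι := ![l, m]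
  let N : Fin 2 → ℕ := fun i => (L i).length
  let b : (i : Fin 2) → Fin (N i) → ι := fun i => (L i).get
  have hb : ∀ i, List.ofFn (b i) = L i := fun i => List.ofFn_get _
  have hN : ∀ i, 0 < N i := by
    intro i
    fin_cases i
    · exact List.length_pos_of_ne_nil hl
    · exact List.length_pos_of_ne_nil hm
  have hg : ∀ i, (List.ofFn (γ ∘ b i)).prod = ![x, y] i := by
    intro i
    rw [← List.map_ofFn, hb]
    fin_cases i
    · exact hx
    · exact hy
  have hs : blockPerm N (Equiv.swap 0 1) ∈ symTuple (γ ∘ concatTuple b) :=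
    blockPerm_mem_symTuple (g := fun i => γ ∘ b i) hg (swap_mem_symTuple h)
  have e1 : l ++ m = List.ofFn (concatTuple b) := by
    rw [ofFn_concatTuple]
    simp only [hb]
    simp [L, List.ofFn_succ]
  have e2 : m ++ l = List.ofFn (concatTuple b ∘ blockPerm N (Equiv.swap 0 1)) := by
    rw [ofFn_concatTuple_comp_blockPerm]
    simp only [hb]
    simp [L, List.ofFn_succ]
  exact ⟨_, concatTuple b, ⟨_, hs⟩, e1, e2,
    (hθ.block ![x, y] N hN (fun i => γ ∘ b i) hg ⟨_, swap_mem_symTuple h⟩).symm⟩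

end Rearranges

include hθ in
-- Moving (1,1) past y costs θ_{1,y} as a block and θ_{1,y}² letter by letter.
theorem IsCommutationFunction.pair_one_left (y : G) : θ.pair 1 y (Commute.one_left y) = 1 := by
  let γ : Fin 3 → G := ![1, 1, y]
  have h1 : Rearranges θ γ ([0, 1] ++ [2]) ([2] ++ [0, 1]) (θ.pair 1 y (Commute.one_left y)) :=
    Rearranges.append_comm hθ (by simp) (by simp) (by simp [γ]) (by simp [γ]) _
  have h2 : Rearranges θ γ ([1] ++ [2]) ([2] ++ [1]) (θ.pair 1 y (Commute.one_left y)) :=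
    Rearranges.append_comm hθ (by simp) (by simp) (by simp [γ]) (by simp [γ]) _
  have h3 : Rearranges θ γ ([0] ++ [2]) ([2] ++ [0]) (θ.pair 1 y (Commute.one_left y)) :=
    Rearranges.append_comm hθ (by simp) (by simp) (by simp [γ]) (by simp [γ]) _
  have h4 := Rearranges.trans hθ (h2.append_left hθ [0]) (h3.append_right hθ [1])
  exact mul_eq_left.1 (h1.unique_of_nodup (by decide) h4).symm

namespace Rearranges

include hθ

theorem append_comm_of_prod_eq_one {l : List ι} (hl : (l.map γ).prod = 1) (m : List ι) :
    Rearranges θ γ (l ++ m) (m ++ l) 1 := by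
  by_cases h1 : l = []
  · subst h1; simpa using refl hθ m
  by_cases h2 : m = []
  · subst h2; simpa using refl hθ l
  rw [← hθ.pair_one_left (m.map γ).prod]
  exact append_comm hθ h1 h2 hl rfl _

omit hθ in
-- Lets auxiliary letters be adjoined to the alphabet and discarded afterwards.
theorem of_map {κ : Type*} {γ : κ → G} {f : ι → κ} (hf : Function.Injective f) {l m : List ι}
    (hl : l.Nodup) {c : Fˣ} (h : Rearranges θ γ (l.map f) (m.map f) c) :
    Rearranges θ (γ ∘ f) l m c := by
  have hp := h.prod_eq
  rw [List.map_map, List.map_map] at hp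
  obtain ⟨d, hd⟩ := exists_of_perm (θ := θ) ((List.map_perm_map_iff hf).1 h.perm) hp
  rwa [h.unique_of_nodup (hl.map hf) (hd.map f)]

/-- With a letter inverse to `x`, `z` and a further copy of `x` at hand, exchanging `x` and `z`
in `x w z` has a scalar that does not depend on `w`. -/
theorem exchange_of_exchange_inv {x y x' z : ι} {w : List ι} (hn : (y :: x' :: x :: w ++ [z]).Nodup)
    (hy : γ y * γ x = 1) (hx' : γ x' = γ x) (hz : γ z = γ x) {c : Fˣ}
    (hc : Rearranges θ γ ([x, y] ++ [z]) ([z, y] ++ [x]) c) :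
    Rearranges θ γ ([x] ++ w ++ [z]) ([z] ++ w ++ [x]) c := by
  have hxy : γ x * γ y = 1 := mul_eq_one_comm.1 hy
  obtain ⟨d, hd⟩ : ∃ d, Rearranges θ γ ([x] ++ w ++ [z]) ([z] ++ w ++ [x]) d := by
    exact exists_of_perm (perm_exchange x z w) (by simp [hz])
  suffices h : d = c by rwa [h] at hd
  have move : ∀ t : ι, γ t = γ x → ∀ k : List ι,
      Rearranges θ γ ([y, x'] ++ [t] ++ k) ([t] ++ [y, x'] ++ k) 1 := fun t _ k =>
    (append_comm_of_prod_eq_one hθ (by simp [hx', hy]) [t]).append_right hθ k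
  have h1 := (append_comm_of_prod_eq_one (γ := γ) hθ (l := [x, y]) (by simp [hxy])
    (x' :: w)).append_right hθ [z]
  have h2 := (append_comm_of_prod_eq_one (γ := γ) hθ (l := [z, y]) (by simp [hz, hxy])
    (x' :: w)).append_right hθ [x]
  have h3 := hc.append_left hθ (x' :: w)
  have h4 := move x rfl (w ++ [z])
  have h5 := move z hz (w ++ [x])
  have h6 := hd.append_left hθ [y, x']
  simp only [List.append_assoc, List.cons_append, List.nil_append] at h1 h2 h3 h4 h5 h6
  -- The route is y x' x w z → x y x' w z → x' w x y z → x' w z y x → z y x' w x → y x' z w x. Only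
  -- the third arrow costs anything, namely `c`; the others move a pair with product 1.
  have h7 := ((((h4.trans hθ h1).trans hθ h3).trans hθ (h2.symm hθ)).trans hθ (h5.symm hθ))
  simp only [one_mul, inv_one, mul_one] at h7
  exact h6.unique_of_nodup (by simpa using hn) h7

variable (hdiag : ∀ g : G, θ.pair g g (Commute.refl g) = 1)
include hdiag

theorem exchange {x z : ι} {w : List ι} (hn : ([x] ++ w ++ [z]).Nodup) (h : γ z = γ x) :
    Rearranges θ γ ([x] ++ w ++ [z]) ([z] ++ w ++ [x]) 1 := by
  -- Two fresh letters: `none` is the inverse letter y, and `some none` is the further copy x'.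
  let γ' : Option (Option ι) → G := fun o => o.elim (γ x)⁻¹ fun o => o.elim (γ x) γ
  let f : ι → Option (Option ι) := fun i => some (some i)
  have hf : Function.Injective f := fun i j hij => Option.some_injective _ (Option.some_injective _ hij)
  have hy : γ' none * γ' (f x) = 1 := inv_mul_cancel _
  have hz : γ' (f z) = γ' (f x) := h
  obtain ⟨c, hc⟩ : ∃ c, Rearranges θ γ' ([f x, none] ++ [f z]) ([f z, none] ++ [f x]) c := by
    exact exists_of_perm (perm_exchange (f x) (f z) [none]) (by simp [hz])
  have hn' := hn.map hf
  have hxz : f x ≠ f z := fun e => by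
    have := hf e
    subst this
    simp at hn
  -- The empty middle word identifies `c` with θ_{g,g} for g = `γ x`.
  have h1 := exchange_of_exchange_inv hθ (x' := some none) (w := [])
    (by simpa [f] using fun e => hxz (congrArg f e)) hy rfl hz hc
  have h2 : Rearranges θ γ' ([f x] ++ [] ++ [f z]) ([f z] ++ [] ++ [f x]) 1 := by
    rw [← hdiag (γ x)]
    exact append_comm hθ (l := [f x]) (by simp) (by simp) (by simp [f, γ']) (by simp [f, γ', h]) _
  have hc1 : c = 1 := h1.unique_of_nodup (by simpa using hxz) h2
  subst hc1
  refine of_map (γ := γ') hf hn ?_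
  have := exchange_of_exchange_inv hθ (x' := some none) (w := w.map f)
    (by simpa [f] using hn') hy rfl hz hc
  simpa using this

end Rearranges

include hθ in
theorem IsCommutationFunction.apply_swap (hdiag : ∀ g : G, θ.pair g g (Commute.refl g) = 1)
    {n : ℕ} {g : Fin n → G} {i j : Fin n} (hij : g i = g j)
    (hs : Equiv.swap i j ∈ symTuple g) : θ n g ⟨Equiv.swap i j, hs⟩ = 1 := by
  by_cases hne : i = j
  · subst hne
    simp only [Equiv.swap_self]
    exact hθ.apply_one g _
  have key : ∀ {i j : Fin n} {A w B : List (Fin n)}, g j = g i →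
      List.finRange n = A ++ ([i] ++ w ++ [j]) ++ B → ∀ hs : Equiv.swap i j ∈ symTuple g,
      θ n g ⟨Equiv.swap i j, hs⟩ = 1 := by
    intro i j A w B h e hs
    have hn := List.nodup_finRange n
    rw [e] at hn
    have hx := ((Rearranges.exchange hθ hdiag (hn.of_append_left.of_append_right) h).append_left
      hθ A).append_right hθ B
    have hm : ∀ l : List (Fin n), i ∉ l → j ∉ l → l.map (Equiv.swap i j) = l := by
      intro l hi hj
      conv_rhs => rw [← List.map_id l]
      refine List.map_congr_left fun a ha => Equiv.swap_apply_of_ne_of_ne ?_ ?_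
      · rintro rfl; exact hi ha
      · rintro rfl; exact hj ha
    have e' : A ++ ([j] ++ w ++ [i]) ++ B = (List.finRange n).map (Equiv.swap i j) := by
      simp only [List.nodup_append, List.nodup_cons, List.mem_append, List.mem_singleton] at hn
      rw [e]
      simp only [List.map_append, List.map_cons, List.map_nil, Equiv.swap_apply_left,
        Equiv.swap_apply_right]
      rw [hm A, hm w, hm B] <;> grind
    rw [e', ← e] at hx
    -- The positions themselves serve as letters, so they are distinct even where `g` repeats
    -- values.
    have h1 : Rearranges θ g (List.finRange n) ((List.finRange n).map (Equiv.swap i j))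
        (θ n g ⟨Equiv.swap i j, hs⟩) :=
      ⟨n, id, ⟨_, hs⟩, by rw [List.ofFn_id], by rw [Function.id_comp, List.ofFn_eq_map], rfl⟩
    exact h1.unique_of_nodup (List.nodup_finRange n) hx
  obtain ⟨A, R, e⟩ := List.append_of_mem (List.mem_finRange i)
  have hj : j ∈ A ++ i :: R := e ▸ List.mem_finRange j
  rcases List.mem_append.1 hj with hA | hR
  · obtain ⟨A', w, rfl⟩ := List.append_of_mem hA
    have := key (i := j) (j := i) (A := A') (w := w) (B := R) hij (by simpa using e)
    simpa only [Equiv.swap_comm j i] using this (by rwa [Equiv.swap_comm])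
  · obtain ⟨w, B, rfl⟩ := List.append_of_mem ((List.mem_cons.1 hR).resolve_left (Ne.symm hne))
    exact key (A := A) (w := w) (B := B) hij.symm (by simpa using e) hs

include hθ in
-- Induction on the size of the support: the transposition of `x` and `σ x` exchanges equal entries
-- of `g`, and multiplying `σ` by it shrinks the support.
theorem IsCommutationFunction.apply_of_comp_eq
    (hdiag : ∀ g : G, θ.pair g g (Commute.refl g) = 1) {n : ℕ} {g : Fin n → G} :
    ∀ (σ : Equiv.Perm (Fin n)) (_ : g ∘ σ = g) (hs : σ ∈ symTuple g), θ n g ⟨σ, hs⟩ = 1 := by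
  intro σ
  induction hk : σ.support.card using Nat.strong_induction_on generalizing σ with
  | _ k ih =>
    intro hσ hs
    by_cases h1 : σ = 1
    · subst h1; exact hθ.apply_one g hs
    obtain ⟨x, hx⟩ : ∃ x, σ x ≠ x := by
      by_contra! h
      exact h1 (Equiv.ext h)
    have hgx : g x = g (σ x) := (congrFun hσ x).symm
    have hsw : g ∘ Equiv.swap x (σ x) = g := by
      funext t
      rw [Function.comp_apply, Equiv.swap_apply_def]
      split_ifs with h h
      · rw [h, hgx]
      · rw [h, hgx]
      · rfl
    have hsσ : g ∘ (Equiv.swap x (σ x) * σ : Equiv.Perm (Fin n)) = g := by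
      rw [Equiv.Perm.coe_mul, ← Function.comp_assoc, hsw, hσ]
    have mem : ∀ {τ : Equiv.Perm (Fin n)}, g ∘ τ = g → τ ∈ symTuple g := by
      intro τ h
      change _ = _
      rw [h]
    have h2 := ih _ (hk ▸ Equiv.Perm.card_support_swap_mul hx) _ rfl hsσ (mem hsσ)
    have h3 := hθ.apply_swap hdiag hgx (mem hsw)
    have tr : ∀ (g' : Fin n → G) (_ : g' = g) (τ : Equiv.Perm (Fin n)) (h : τ ∈ symTuple g)
        (h' : τ ∈ symTuple g'), θ n g' ⟨τ, h'⟩ = θ n g ⟨τ, h⟩ := by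
      rintro _ rfl τ h h'; rfl
    have h' : Equiv.swap x (σ x) * σ ∈ symTuple (g ∘ Equiv.swap x (σ x)) := by
      rw [hsw]; exact mem hsσ
    have h4 := hθ.mul g ⟨_, mem hsw⟩ ⟨_, h'⟩
    rw [h3, tr _ hsw _ (mem hsσ) h', h2, one_mul] at h4
    rw [h4]
    congr 1
    exact Subtype.ext (by simp [← mul_assoc])

include hθ in
-- Going along one rearrangement and back along the other is a permutation fixing the word, so it
-- costs 1.
theorem Rearranges.unique (hdiag : ∀ g : G, θ.pair g g (Commute.refl g) = 1) {l m : List ι}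
    {c d : Fˣ} (h : Rearranges θ γ l m c) (h' : Rearranges θ γ l m d) : c = d := by
  obtain ⟨n, a, σ, h1, h2, h3⟩ := h.trans hθ (h'.symm hθ)
  rw [← mul_inv_eq_one, ← h3]
  have ha : a ∘ σ.1 = a := List.ofFn_injective (h2.symm.trans h1)
  exact hθ.apply_of_comp_eq hdiag σ.1 (by rw [Function.comp_assoc, ha]) σ.2

end Rearrangement

/-! ### From rearrangement scalars to a scalar for every word. -/

section Extension

variable {G : Type u} [Group G] {F : Type v} [Field F]

/-- Homomorphisms to the unit group of an algebraically closed field extend from subgroups of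
commutative groups. -/
theorem exists_monoidHom_comp_eq_id [IsAlgClosed F] [CharZero F] {K : Type w} [CommGroup K]
    (j : Fˣ →* K) (hj : Function.Injective j) : ∃ f : K →* Fˣ, ∀ a, f (j a) = a := by
  -- Existence of n-th roots makes Fˣ divisible, hence an injective ℤ-module, so the identity of Fˣ
  -- extends along `j`.
  have hsurj : ∀ {n : ℕ}, n ≠ 0 → Function.Surjective fun a : Additive Fˣ => n • a := by
    intro n hn a
    obtain ⟨z, hz⟩ := IsAlgClosed.exists_pow_nat_eq ((Additive.toMul a : Fˣ) : F)
      (Nat.pos_of_ne_zero hn)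
    have hz0 : z ≠ 0 := by
      rintro rfl
      rw [zero_pow hn] at hz
      exact (Additive.toMul a).ne_zero hz.symm
    exact ⟨Additive.ofMul (Units.mk0 z hz0), congrArg Additive.ofMul (Units.ext hz :
      (Units.mk0 z hz0) ^ n = Additive.toMul a)⟩
  let _ : DivisibleBy (Additive Fˣ) ℕ := divisibleByOfSMulRightSurj _ _ hsurj
  let _ : DivisibleBy (Additive Fˣ) ℤ := AddGroup.divisibleByIntOfDivisibleByNat _
  obtain ⟨f, hf⟩ := (Module.Baer.of_divisible (Additive Fˣ)).extension_property_addMonoidHom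
    (MonoidHom.toAdditive j) hj (AddMonoidHom.id _)
  exact ⟨MonoidHom.toAdditive.symm f, fun a => DFunLike.congr_fun hf (Additive.ofMul a)⟩

variable {θ : PairFunction G F}

/-- The monoid of words in `G` with product `1`. -/
abbrev UnitWord (G : Type u) [Group G] : Type u :=
  MonoidHom.mker (FreeMonoid.lift (id : G → G))

theorem UnitWord.prod_eq_one (l : UnitWord G) : (l.1.toList.map id).prod = 1 := by
  have h := l.2
  rwa [MonoidHom.mem_mker, FreeMonoid.lift_apply] at h

/-- The word attached to a list with product `1`. -/
def UnitWord.mk {l : List G} (h : l.prod = 1) : UnitWord G :=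
  ⟨FreeMonoid.ofList l, by rw [MonoidHom.mem_mker, FreeMonoid.lift_apply]; simpa using h⟩

/-- The congruence on multiples of words with product `1` which identifies every word with the
multiples of its rearrangements that `θ` prescribes. -/
def unitWordCon (hθ : IsCommutationFunction θ) : Con (Fˣ × UnitWord G) where
  r p q := Rearranges θ id p.2.1.toList q.2.1.toList (p.1⁻¹ * q.1)
  iseqv :=
    { refl := fun p => by rw [inv_mul_cancel]; exact Rearranges.refl hθ _
      symm := fun {p q} h => by simpa using h.symm hθ
      trans := fun {p q r} h h' => by simpa [mul_assoc] using h.trans hθ h' }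
  mul' := by
    intro p p' q q' h h'
    have := (h.append_right hθ q.2.1.toList).trans hθ (h'.append_left hθ p'.2.1.toList)
    have e : p.1⁻¹ * p'.1 * (q.1⁻¹ * q'.1) = (p.1 * q.1)⁻¹ * (p'.1 * q'.1) := by
      rw [mul_inv, mul_mul_mul_comm]
    rwa [e] at this

instance (hθ : IsCommutationFunction θ) : CommMonoid (unitWordCon hθ).Quotient where
  mul_comm x y := by
    induction x using Con.induction_on with | _ p
    induction y using Con.induction_on with | _ q
    refine (Con.eq _).2 ?_
    have := Rearranges.append_comm_of_prod_eq_one hθ (UnitWord.prod_eq_one p.2) q.2.1.toList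
    have e : (p.1 * q.1)⁻¹ * (q.1 * p.1) = 1 := by rw [mul_comm q.1, inv_mul_cancel]
    rwa [← e] at this

theorem IsCommutationFunction.exists_hom_unitWord [IsAlgClosed F] [CharZero F]
    (hθ : IsCommutationFunction θ) (hdiag : ∀ g : G, θ.pair g g (Commute.refl g) = 1) :
    ∃ ψ : UnitWord G →* Fˣ, ∀ l m c, Rearranges θ id l.1.toList m.1.toList c →
      ψ l = c * ψ m := by
  let ν : Fˣ × UnitWord G →* (unitWordCon hθ).Quotient := (unitWordCon hθ).mk'
  let π : Fˣ × UnitWord G →* Algebra.GrothendieckGroup (unitWordCon hθ).Quotient :=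
    Algebra.GrothendieckGroup.of.comp ν
  obtain ⟨f, hf⟩ := exists_monoidHom_comp_eq_id (π.comp (MonoidHom.inl _ _)) (by
    intro a b hab
    -- Equality in the Grothendieck group means equality after multiplying by some `z`. The word of
    -- `z` then rearranges to itself at price a⁻¹b, which uniqueness forces to be 1.
    obtain ⟨⟨z, _⟩, hz⟩ := (Localization.monoidOf ⊤).eq_iff_exists.1 hab
    obtain ⟨p, rfl⟩ := Con.mk'_surjective z
    have h : Rearranges θ id (p.2.1.toList ++ []) (p.2.1.toList ++ []) ((p.1 * a)⁻¹ * (p.1 * b)) :=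
      (Con.eq (unitWordCon hθ)).1 hz
    have := h.unique hθ hdiag (Rearranges.refl hθ _)
    exact mul_left_cancel (inv_mul_eq_one.1 this))
  refine ⟨(f.comp π).comp (MonoidHom.inr _ _), fun l m c h => ?_⟩
  have h0 : ν (1, l) = ν (c, m) := by
    refine (Con.eq (unitWordCon hθ)).2 ?_
    change Rearranges θ id l.1.toList m.1.toList (1⁻¹ * c)
    rwa [inv_one, one_mul]
  have h1 : π (1, l) = π (c, m) := congrArg Algebra.GrothendieckGroup.of h0
  have h2 : ((c, m) : Fˣ × UnitWord G) = (c, 1) * (1, m) := by simp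
  change f (π (1, l)) = c * f (π (1, m))
  rw [h1, h2, map_mul, map_mul]
  congr 1
  exact hf c

/-- A scalar for every list with product `1`, compatible with concatenation and with
rearrangements. -/
theorem IsCommutationFunction.exists_unit_list_scalar [IsAlgClosed F] [CharZero F]
    (hθ : IsCommutationFunction θ) (hdiag : ∀ g : G, θ.pair g g (Commute.refl g) = 1) :
    ∃ φ : List G → Fˣ, (∀ l m, l.prod = 1 → m.prod = 1 → φ (l ++ m) = φ l * φ m) ∧
      ∀ l m c, l.prod = 1 → Rearranges θ id l m c → φ l = c * φ m := by
  classical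
  obtain ⟨ψ, hψ⟩ := hθ.exists_hom_unitWord hdiag
  -- The value 1 on lists with product other than 1 is arbitrary.
  refine ⟨fun l => if h : l.prod = 1 then ψ (.mk h) else 1, ?_, ?_⟩
  · intro l m hl hm
    have hlm : (l ++ m).prod = 1 := by rw [List.prod_append, hl, hm, one_mul]
    simp only [dif_pos hl, dif_pos hm, dif_pos hlm]
    rw [← map_mul]
    rfl
  · intro l m c hl h
    have hm : m.prod = 1 := by simpa [hl] using h.prod_eq.symm
    simp only [dif_pos hl, dif_pos hm]
    exact hψ (.mk hl) (.mk hm) c h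

/-- Both this flip, after a leading x, and the free move of x x⁻¹ past x turn x x⁻¹ x into x x x⁻¹.
The letter x repeats, so comparing the two prices takes `unique`. -/
theorem Rearranges.inv_pair (hθ : IsCommutationFunction θ)
    (hdiag : ∀ g : G, θ.pair g g (Commute.refl g) = 1) (x : G) :
    Rearranges θ id [x⁻¹, x] [x, x⁻¹] 1 := by
  obtain ⟨d, hd⟩ : ∃ d, Rearranges θ id [x⁻¹, x] [x, x⁻¹] d :=
    exists_of_perm (List.Perm.swap _ _ _) (by simp)
  have h : Rearranges θ id ([x, x⁻¹] ++ [x]) ([x] ++ [x, x⁻¹]) 1 :=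
    append_comm_of_prod_eq_one hθ (by simp) _
  rwa [(hd.append_left hθ [x]).unique hθ hdiag h] at hd

/-- Scalars `s(l)` such that one can require `U_{g₁} ⋯ U_{gₙ} = s(g₁, …, gₙ) U_{g₁ ⋯ gₙ}`. -/
theorem IsCommutationFunction.exists_list_scalar [IsAlgClosed F] [CharZero F]
    (hθ : IsCommutationFunction θ) (hdiag : ∀ g : G, θ.pair g g (Commute.refl g) = 1) :
    ∃ s : List G → Fˣ, (∀ g, s [g] = 1) ∧
      (∀ l m, s (l ++ m) = s l * s m * s [l.prod, m.prod]) ∧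
      ∀ l m c, Rearranges θ id l m c → s l = c * s m := by
  obtain ⟨φ, hmul, hφ⟩ := hθ.exists_unit_list_scalar hdiag
  refine ⟨fun l => φ (l ++ [l.prod⁻¹]) * (φ [l.prod, l.prod⁻¹])⁻¹, ?_, ?_, ?_⟩
  · intro g
    simp
  · intro l m
    obtain ⟨x, hx⟩ : ∃ x, l.prod = x := ⟨_, rfl⟩
    obtain ⟨y, hy⟩ : ∃ y, m.prod = y := ⟨_, rfl⟩
    have move : ∀ d k : List G, d.prod = 1 → Rearranges θ id (d ++ k) (k ++ d) 1 :=
      fun d k hd => Rearranges.append_comm_of_prod_eq_one hθ (by simpa using hd) k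
    have h1 := (((move (m ++ [y⁻¹]) [x⁻¹] (by simp [hy])).symm hθ).append_left hθ l).append_right hθ
      [x, y, (x * y)⁻¹]
    have h2 := (move [x⁻¹, x] [y, (x * y)⁻¹] (by simp)).append_left hθ (l ++ m ++ [y⁻¹])
    have h3 := (move [y⁻¹, y] [(x * y)⁻¹, x⁻¹, x] (by simp)).append_left hθ (l ++ m)
    have h4 := ((Rearranges.inv_pair hθ hdiag x).append_left hθ (l ++ m ++ [(x * y)⁻¹])).append_right
      hθ [y⁻¹, y]
    have h5 := (Rearranges.inv_pair hθ hdiag y).append_left hθ (l ++ m ++ [(x * y)⁻¹] ++ [x, x⁻¹])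
    simp only [List.append_assoc, List.cons_append, List.nil_append] at h1 h2 h3 h4 h5
    -- Altogether l x⁻¹ m y⁻¹ x y (xy)⁻¹ becomes l m (xy)⁻¹ x x⁻¹ y y⁻¹ for free. Both sides split
    -- into words with product 1, and applying φ gives the formula for `s (l ++ m)`.
    have h6 := (((h1.trans hθ h2).trans hθ h3).trans hθ h4).trans hθ h5
    simp only [inv_one, mul_one] at h6
    have h7 : φ ((l ++ [x⁻¹]) ++ ((m ++ [y⁻¹]) ++ [x, y, (x * y)⁻¹])) =
        1 * φ ((l ++ m ++ [(x * y)⁻¹]) ++ ([x, x⁻¹] ++ [y, y⁻¹])) :=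
      hφ _ _ _ (by simp [hx, hy]) (by simpa only [List.append_assoc, List.cons_append,
        List.nil_append] using h6)
    have hx1 : (l ++ [x⁻¹]).prod = 1 := by simp [hx]
    have hy1 : (m ++ [y⁻¹]).prod = 1 := by simp [hy]
    have hxy1 : [x, y, (x * y)⁻¹].prod = 1 := by simp
    have hlm1 : (l ++ m ++ [(x * y)⁻¹]).prod = 1 := by simp [hx, hy]
    rw [hmul _ _ hx1 (by rw [List.prod_append, hy1, hxy1, one_mul]), hmul _ _ hy1 hxy1,
      hmul _ _ hlm1 (by simp), hmul [x, x⁻¹] _ (by simp) (by simp), one_mul] at h7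
    simp only [List.prod_append, hx, hy, List.prod_cons, List.prod_nil, mul_one, List.cons_append,
      List.nil_append]
    rw [mul_inv_eq_iff_eq_mul]
    have h8 : φ (l ++ m ++ [(x * y)⁻¹]) = φ (l ++ [x⁻¹]) * (φ (m ++ [y⁻¹]) * φ [x, y, (x * y)⁻¹]) *
        (φ [x, x⁻¹] * φ [y, y⁻¹])⁻¹ := by
      rw [h7, mul_inv_cancel_right]
    rw [h8]
    simp only [mul_inv]
    generalize φ (l ++ [x⁻¹]) = a, φ (m ++ [y⁻¹]) = b, φ [x, y, (x * y)⁻¹] = c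
    rw [mul_assoc (_ * _ * _), mul_assoc (_ * _), inv_mul_cancel_right]
    ac_rfl
  · intro l m c h
    have hp : l.prod = m.prod := by simpa using h.prod_eq
    have h1 := h.append_right hθ [m.prod⁻¹]
    simp only [hp, hφ _ _ _ (by simp [hp]) h1, mul_assoc]

end Extension

/-! ### The natural grading of the twisted group algebra. -/

section TwistedGroupAlgebra

variable {G : Type u} [Group G] {F : Type v} [Field F] (α : TwoCocycle G F)

open TwistedGroupAlgebra

theorem TwistedGroupAlgebra.one_eq :
    (1 : TwistedGroupAlgebra α) = (((α (1, 1))⁻¹ : Fˣ) : F) • U α 1 :=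
  (Finsupp.smul_single_one (1 : G) ((((α (1, 1))⁻¹ : Fˣ) : F))).symm

theorem TwistedGroupAlgebra.isGrading_component : IsGrading (component α) where
  indep := by
    have : LinearIndependent F (fun g : G => (Finsupp.single g (1 : F))) :=
      Finsupp.linearIndependent_single_one F G
    exact this.iSupIndep_span_singleton
  iSup_eq_top := by
    rw [eq_top_iff]
    rintro x -
    induction x using Finsupp.induction_linear with
    | zero => exact zero_mem _
    | add x y hx hy => exact add_mem hx hy
    | single g a =>
      refine Submodule.mem_iSup_of_mem g (Submodule.mem_span_singleton.2 ⟨a, ?_⟩)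
      exact Finsupp.smul_single_one g a
  mul_mem := by
    intro g h a b ha hb
    obtain ⟨r, rfl⟩ := Submodule.mem_span_singleton.1 ha
    obtain ⟨t, rfl⟩ := Submodule.mem_span_singleton.1 hb
    rw [smul_mul_smul_comm, U_mul_U, smul_smul]
    exact Submodule.smul_mem _ _ (Submodule.mem_span_singleton_self _)

theorem TwistedGroupAlgebra.U_ne_zero (g : G) : U α g ≠ 0 :=
  Finsupp.single_ne_zero.2 one_ne_zero

end TwistedGroupAlgebra

theorem prod_ofFn_smul {F A : Type*} [CommSemiring F] [Semiring A] [Algebra F A] :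
    ∀ {n : ℕ} (r : Fin n → F) (a : Fin n → A),
      (List.ofFn fun i => r i • a i).prod = (∏ i, r i) • (List.ofFn a).prod
  | 0, _, _ => by simp
  | n + 1, r, a => by
    simp only [List.ofFn_succ, List.prod_cons, Fin.prod_univ_succ]
    rw [prod_ofFn_smul, smul_mul_smul_comm]

end RegularGrading

/-! ### Construction of the cocycle. -/

open RegularGrading in
theorem mainTheorem9 {G : Type*} [Group G] {F : Type*} [Field F] [IsAlgClosed F] [CharZero F]
    (θ : PairFunction G F) (hθ : IsCommutationFunction θ)
    (hdiag : ∀ g : G, PairFunction.pair θ g g (Commute.refl g) = 1) :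
    ∃ α : TwoCocycle G F, IsRegularGradingWith (TwistedGroupAlgebra.component α) θ := by
  obtain ⟨s, hs1, hs2, hs3⟩ := hθ.exists_list_scalar hdiag
  -- The cocycle identity comes from splitting `s [g, h, k]` after two letters and after one.
  let α : TwoCocycle G F := ⟨fun p => s [p.1, p.2], by
    intro g h k
    have h1 := hs2 [g, h] [k]
    have h2 := hs2 [g] [h, k]
    simp only [hs1, List.cons_append, List.nil_append, List.prod_cons, List.prod_nil, mul_one,
      one_mul] at h1 h2
    change s [g * h, k] * s [g, h] = s [h, k] * s [g, h * k]
    rw [mul_comm (s [g * h, k]), ← h1, h2]⟩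
  have hU : ∀ l : List G, (l.map (TwistedGroupAlgebra.U α)).prod =
      (s l : F) • TwistedGroupAlgebra.U α l.prod := by
    intro l
    induction l with
    | nil =>
      -- This forces `s []` to be α(1,1)⁻¹, the coefficient of U₁ in the unit of the algebra.
      have h : s [] = s [] * s [] * s [1, 1] := hs2 [] []
      have h' : s [] = (s [1, 1])⁻¹ := by
        rw [mul_assoc] at h
        exact eq_inv_of_mul_eq_one_left (mul_eq_left.1 h.symm)
      rw [h']
      exact TwistedGroupAlgebra.one_eq α
    | cons g l ih =>
      have h := hs2 [g] l
      rw [hs1, one_mul, List.prod_singleton, List.singleton_append] at h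
      rw [List.map_cons, List.prod_cons, ih, mul_smul_comm, TwistedGroupAlgebra.U_mul_U, smul_smul,
        h, List.prod_cons, Units.val_mul]
  refine ⟨α, ⟨TwistedGroupAlgebra.isGrading_component α, ?_, ?_⟩⟩
  · intro n g σ a ha
    choose r hr using fun i => Submodule.mem_span_singleton.1 (ha i)
    obtain rfl : (fun i => r i • TwistedGroupAlgebra.U α (g i)) = a := funext hr
    have e : (fun i => r i • TwistedGroupAlgebra.U α (g i)) ∘ σ.1 =
        fun i => r (σ.1 i) • TwistedGroupAlgebra.U α ((g ∘ σ.1) i) := rfl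
    have e' : ∀ h : Fin n → G, List.ofFn (fun i => TwistedGroupAlgebra.U α (h i)) =
        (List.ofFn h).map (TwistedGroupAlgebra.U α) := fun h => by
      rw [List.map_ofFn]; rfl
    rw [e, prod_ofFn_smul, prod_ofFn_smul, Equiv.prod_comp σ.1 r, e', e', hU, hU,
      hs3 _ _ (θ n g σ) ⟨n, g, σ, rfl, rfl, rfl⟩, ← σ.2, Units.val_mul]
    simp only [smul_smul]
    congr 1
    ring
  · intro n g
    refine ⟨fun i => TwistedGroupAlgebra.U α (g i),
      fun i => Submodule.mem_span_singleton_self _, ?_⟩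
    have e : List.ofFn (fun i => TwistedGroupAlgebra.U α (g i)) =
        (List.ofFn g).map (TwistedGroupAlgebra.U α) := by
      rw [List.map_ofFn]; rfl
    rw [e, hU]
    exact smul_ne_zero (Units.ne_zero _) (TwistedGroupAlgebra.U_ne_zero α _)
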